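/- Let $\Delta$ be a simplicial complex on a finite vertex set $V$ (every $\{v\}$, $v\in V$, is a face, and $\emptyset$ is a face) of dimension $d-1$, and let $f_i$ be the number of $i$-dimensional faces of $\Delta$, where a face with $i+1$ elements has dimension $i$ (so $f_{-1}=1$). Let $k$ be a field, let $I_\Delta\subseteq k[x_v : v\in V]$ be the ideal generated by the squarefree monomials $\prod_{v\in s}x_v$ with $s\subseteq V$, $s\notin\Delta$, let $k[\Delta]=k[x_v: v\in V]/I_\Delta$ be the face ring, and let $\mathfrak m$ be its maximal homogeneous ideal, generated by the classes of the $x_v$. For an ideal $I$ of a ring $R$ let $\overline I$ be its integral closure, the ideal of all $x\in R$ that satisfy an equation $x^n+a_1x^{n-1}+\cdots+a_n=0$ with $n\ge 1$ and $a_j\in I^j$ for $1\le j\le n$. For $D=\dim k[\Delta]$, let the Hilbert coefficients $e_i(\mathfrak m)$ and the normal Hilbert coefficients $\overline e_i(\mathfrak m)$, $0\le i\le D$, be the integers such that, for all large $n$, the lengths $$\lambda(k[\Delta]/\mathfrak m^n)=\sum_{i=0}^{D}(-1)^i e_i(\mathfrak m)\binom{n+D-1-i}{D-i},\qquad \lambda(k[\Delta]/\overline{\mathfrak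 m^n})=\sum_{i=0}^{D}(-1)^i\,\overline e_i(\mathfrak m)\binom{n+D-1-i}{D-i}$$ are finite and given by these polynomials in $n$. Then: 1. $\overline{\mathfrak m^n}=\mathfrak m^n$ for all $n\ge 0$. 2. The Hilbert coefficients $e_i(\mathfrak m)$ and $\overline e_i(\mathfrak m)$ exist, and if $d\ge 1$, then $\overline e_1(\mathfrak m)=e_1(\mathfrak m)=d f_{d-1}-f_{d-2}$. 3. If $d\ge 1$ and $\Delta$ is pure (all inclusion-maximal faces have the same dimension), then $\overline e_1(\mathfrak m)=e_1(\mathfrak m)\ge 0$. -/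

import Mathlib

open Polynomial Filter

noncomputable section

/-! ### Simplicial complexes

Mathlib's `AbstractSimplicialComplex V` is a downward closed family of nonempty finite subsets
of `V` that contains all singletons. The empty face (of dimension `-1`) is added here. -/

namespace AbstractSimplicialComplex

variable {V : Type*}

/-- The faces of `Δ`, the empty face included. -/
def IsFace (Δ : AbstractSimplicialComplex V) (s : Finset V) : Prop :=
  s = ∅ ∨ s ∈ Δ

/-- The number `f_i` of faces of dimension `i`; a face with `i + 1` vertices has dimension `i`. -/
def faceNumber (Δ : AbstractSimplicialComplex V) (i : ℤ) : ℕ :=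
  {s : Finset V | Δ.IsFace s ∧ (s.card : ℤ) - 1 = i}.ncard

/-- `Δ` has dimension `i`: this is the largest dimension of a face. -/
def HasDim (Δ : AbstractSimplicialComplex V) (i : ℤ) : Prop :=
  IsGreatest {j : ℤ | ∃ s : Finset V, Δ.IsFace s ∧ (s.card : ℤ) - 1 = j} i

/-- A facet is a face that is maximal under inclusion. -/
def IsFacet (Δ : AbstractSimplicialComplex V) (s : Finset V) : Prop :=
  Maximal Δ.IsFace s

/-- `Δ` is pure if all its facets have the same dimension. -/
def IsPure (Δ : AbstractSimplicialComplex V) : Prop :=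
  ∀ s t : Finset V, Δ.IsFacet s → Δ.IsFacet t → s.card = t.card

/-- The ideal `I_Δ` generated by the squarefree monomials whose support is not a face. -/
def faceIdeal (k : Type*) [Field k] (Δ : AbstractSimplicialComplex V) :
    Ideal (MvPolynomial V k) :=
  Ideal.span {p | ∃ s : Finset V, ¬ Δ.IsFace s ∧ p = ∏ v ∈ s, MvPolynomial.X v}

/-- The face ring (Stanley–Reisner ring) `k[Δ]`. -/
abbrev FaceRing (k : Type*) [Field k] (Δ : AbstractSimplicialComplex V) : Type _ :=
  MvPolynomial V k ⧸ Δ.faceIdeal k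

/-- The maximal homogeneous ideal of `k[Δ]`, generated by the classes of the variables. -/
def maxHomogeneousIdeal (k : Type*) [Field k] (Δ : AbstractSimplicialComplex V) :
    Ideal (Δ.FaceRing k) :=
  Ideal.span (Set.range fun v : V => Ideal.Quotient.mk (Δ.faceIdeal k) (MvPolynomial.X v))

end AbstractSimplicialComplex

/-! ### Integral closure of ideals -/

/-- `x` is integral over the ideal `I`: it satisfies an equation
`x ^ n + a₁ x ^ (n - 1) + ⋯ + aₙ = 0` with `aⱼ ∈ I ^ j`. Here `p` is the left-hand side as a
polynomial in `x`, so that `aⱼ` is its coefficient of index `n - j`. -/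
def IsIntegralOverIdeal {R : Type*} [CommRing R] (I : Ideal R) (x : R) : Prop :=
  ∃ p : R[X], p.Monic ∧ p.eval x = 0 ∧ ∀ i, p.coeff i ∈ I ^ (p.natDegree - i)

lemma isIntegralOverIdeal_iff {R : Type*} [CommRing R] (I : Ideal R) (x : R) :
    IsIntegralOverIdeal I x ↔
      IsIntegral (Algebra.adjoin R {C r * X | r ∈ I} : Subalgebra R R[X]) (C x * X) := by
  constructor
  · rintro ⟨p, hp, hx, hc⟩
    have hmem : ∀ i, C (p.coeff i) * X ^ (p.natDegree - i) ∈
        (Algebra.adjoin R {C r * X | r ∈ I} : Subalgebra R R[X]) := by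
      intro i
      have h1 := monomial_mem_adjoin_monomial (hc i)
      rw [← C_mul_X_pow_eq_monomial] at h1
      refine Algebra.adjoin_mono ?_ h1
      rintro _ ⟨r, hr, rfl⟩
      exact ⟨r, hr, by rw [← pow_one (X : R[X]), C_mul_X_pow_eq_monomial]⟩
    refine ⟨∑ i ∈ Finset.range (p.natDegree + 1), C ⟨_, hmem i⟩ * X ^ i, ?_, ?_⟩
    · rw [Finset.sum_range_succ, add_comm]
      have h1 : (⟨_, hmem p.natDegree⟩ :
          (Algebra.adjoin R {C r * X | r ∈ I} : Subalgebra R R[X])) = 1 := by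
        ext1
        simp [hp]
      rw [h1, C_1, one_mul]
      refine monic_X_pow_add (lt_of_le_of_lt (degree_sum_le _ _) ?_)
      rw [Finset.sup_lt_iff (WithBot.bot_lt_coe _)]
      intro i hi
      exact lt_of_le_of_lt (degree_C_mul_X_pow_le _ _)
        (by exact_mod_cast Finset.mem_range.1 hi)
    · rw [eval₂_finsetSum]
      have h2 : C (p.eval x) * (X : R[X]) ^ p.natDegree = 0 := by rw [hx]; simp
      rw [eval_eq_sum_range, map_sum, Finset.sum_mul] at h2
      rw [← h2]
      refine Finset.sum_congr rfl fun i hi => ?_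
      have hi' : i ≤ p.natDegree := Nat.lt_succ_iff.1 (Finset.mem_range.1 hi)
      simp only [eval₂_mul, eval₂_C, eval₂_pow, eval₂_X, Subalgebra.algebraMap_def,
        C_mul, C_pow]
      conv_rhs => rw [← Nat.sub_add_cancel hi', pow_add]
      change C (p.coeff i) * X ^ (p.natDegree - i) * (C x * X) ^ i = _
      ring
  · intro h
    obtain ⟨p, hp, hx, hc⟩ :=
      exists_monic_aeval_eq_zero_forall_mem_pow_of_isIntegral (R := R) (S := R) (I := I) (x := x)
        (by
          convert h using 1
          ext r y
          change ((Polynomial.map (algebraMap R R) r.1 * y).coeff _) = (r.1 * y).coeff _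
          rw [Algebra.algebraMap_self, Polynomial.map_id])
    exact ⟨p, hp, by simpa [coe_aeval_eq_eval] using hx, hc⟩

/-- The integral closure of an ideal: the ideal of all elements integral over it. -/
def integralClosureIdeal {R : Type*} [CommRing R] (I : Ideal R) : Ideal R where
  carrier := {x | IsIntegralOverIdeal I x}
  zero_mem' := by
    simp only [Set.mem_ofPred_eq, isIntegralOverIdeal_iff, C_0, zero_mul]
    exact isIntegral_zero
  add_mem' := by
    intro x y hx hy
    simp only [Set.mem_ofPred_eq, isIntegralOverIdeal_iff] at hx hy ⊢
    rw [C_add, add_mul]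
    exact hx.add hy
  smul_mem' := by
    intro c x hx
    simp only [Set.mem_ofPred_eq, isIntegralOverIdeal_iff] at hx ⊢
    rw [smul_eq_mul, C_mul, mul_assoc]
    exact (isIntegral_algebraMap (R := (Algebra.adjoin R {C r * X | r ∈ I} : Subalgebra R R[X]))
      (x := algebraMap R _ c)).mul hx

/-! ### Hilbert coefficients of filtrations -/

/-- `P` is the Hilbert polynomial of the filtration `F`: the length of `R / F n` is finite and
equal to `P(n)` for all large `n`. -/
def IsHilbertPolynomial {R : Type*} [CommRing R] (F : ℕ → Ideal R) (P : ℚ[X]) : Prop :=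
  ∀ᶠ n : ℕ in atTop, ∃ l : ℕ, Module.length R (R ⧸ F n) = l ∧ P.eval (n : ℚ) = l

/-- `e 0, …, e d` are the Hilbert coefficients of the filtration `F` of the `d`-dimensional ring
`R`: the Hilbert polynomial of `F` is `∑ i ≤ d, (-1) ^ i * e i * binom(x + d - i - 1, d - i)`.
The values `e i` for `i > d` are irrelevant.
(`preHilbertPoly ℚ j 1` is the polynomial `binom(x + j - 1, j) = x (x + 1) ⋯ (x + j - 1) / j!`.) -/
def IsHilbertCoeffs {R : Type*} [CommRing R] (F : ℕ → Ideal R) (e : ℕ → ℤ) : Prop :=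
  ∃ d : ℕ, ringKrullDim R = d ∧
    IsHilbertPolynomial F
      (∑ i ∈ Finset.range (d + 1), C ((-1 : ℚ) ^ i * (e i : ℚ)) * preHilbertPoly ℚ (d - i) 1)

/-- The `I`-adic filtration `I ^ n`. -/
def adicFiltration {R : Type*} [CommRing R] (I : Ideal R) (n : ℕ) : Ideal R :=
  I ^ n

/-- The integral closure filtration, formed by the integral closures of the powers `I ^ n`. -/
def normalFiltration {R : Type*} [CommRing R] (I : Ideal R) (n : ℕ) : Ideal R :=
  integralClosureIdeal (I ^ n)

end

noncomputable section

/-! ### Monomial descriptions of the face ideal and of the powers of 𝔪 -/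

namespace AbstractSimplicialComplex

variable {V : Type*} {k : Type*} [Field k] {Δ : AbstractSimplicialComplex V}

/-! The monomials supported on faces form a basis of k[Δ], and those of degree at least n span 𝔪^n
(`mk_mem_maxHomogeneousIdeal_pow_iff`). For a face s, killing the variables outside s maps k[Δ] to
the polynomial ring k[s], keeps the coefficients at exponents supported in s, and sends 𝔪 into the
ideal of the variables. In k[s] the lowest degree is additive on products, so powers of that ideal
are integrally closed; hence so is 𝔪^n.

The normal and adic filtrations therefore coincide, and one Hilbert function remains. The length of
k[Δ]/𝔪^n is the number of face monomials of degree < n, which is ∑ f_{j-1} C(n-1, j)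
(`ncard_faceExponents`). Rewriting this in the basis C(n-1+l, l) gives all the coefficients, e_1
among them. If Δ is pure, every codimension one face is a facet minus a vertex, so f_{d-2} ≤ d
f_{d-1}. -/

lemma isFace_empty (Δ : AbstractSimplicialComplex V) : Δ.IsFace ∅ := Or.inl rfl

lemma IsFace.mono {s t : Finset V} (ht : Δ.IsFace t) (hst : s ⊆ t) : Δ.IsFace s := by
  rcases s.eq_empty_or_nonempty with rfl | hs
  · exact Δ.isFace_empty
  · rcases ht with rfl | ht
    · exact absurd (Finset.subset_empty.1 hst) hs.ne_empty
    · exact Or.inr ((Δ.isRelLowerSet_faces ht).2 hst hs)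

lemma prod_X_eq_monomial (s : Finset V) :
    (∏ v ∈ s, MvPolynomial.X v : MvPolynomial V k) =
      MvPolynomial.monomial (∑ v ∈ s, Finsupp.single v 1) 1 := by
  classical
  rw [MvPolynomial.monomial_sum_one]
  rfl

lemma sum_single_one_le_iff (s : Finset V) (m : V →₀ ℕ) :
    ∑ v ∈ s, Finsupp.single v 1 ≤ m ↔ s ⊆ m.support := by
  classical
  simp only [Finsupp.le_def, Finsupp.finsetSum_apply, Finsupp.single_apply, Finset.sum_ite_eq',
    Finset.subset_iff, Finsupp.mem_support_iff]
  refine forall_congr' fun v => ?_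
  split_ifs with h <;> simp [h, Nat.one_le_iff_ne_zero]

/-- The face ideal consists of the polynomials without monomials supported on a face. -/
lemma mem_faceIdeal_iff {p : MvPolynomial V k} :
    p ∈ Δ.faceIdeal k ↔ ∀ m, Δ.IsFace m.support → p.coeff m = 0 := by
  have h : Δ.faceIdeal k = Ideal.span ((fun m => MvPolynomial.monomial m (1 : k)) ''
      {m | ∃ s : Finset V, ¬ Δ.IsFace s ∧ m = ∑ v ∈ s, Finsupp.single v 1}) := by
    rw [faceIdeal]
    congr 1
    ext p
    constructor
    · rintro ⟨s, hs, rfl⟩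
      exact ⟨_, ⟨s, hs, rfl⟩, (prod_X_eq_monomial s).symm⟩
    · rintro ⟨_, ⟨s, hs, rfl⟩, rfl⟩
      exact ⟨s, hs, (prod_X_eq_monomial s).symm⟩
  rw [h, MvPolynomial.mem_ideal_span_monomial_image]
  refine forall_congr' fun m => ?_
  rw [MvPolynomial.mem_support_iff]
  constructor
  · intro H hm
    by_contra hc
    obtain ⟨_, ⟨s, hs, rfl⟩, hle⟩ := H hc
    exact hs (hm.mono ((sum_single_one_le_iff s m).1 hle))
  · intro H hc
    exact ⟨_, ⟨m.support, fun hm => hc (H hm), rfl⟩, (sum_single_one_le_iff _ m).2 subset_rfl⟩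

lemma maxHomogeneousIdeal_eq_map :
    Δ.maxHomogeneousIdeal k =
      (MvPolynomial.idealOfVars V k).map (Ideal.Quotient.mk (Δ.faceIdeal k)) := by
  rw [maxHomogeneousIdeal, MvPolynomial.idealOfVars, Ideal.map_span, ← Set.range_comp]
  rfl

/-- The preimage of 𝔪^n is a sum of two monomial ideals, so membership is tested on each monomial
separately. -/
lemma mk_mem_maxHomogeneousIdeal_pow_iff {n : ℕ} {p : MvPolynomial V k} :
    Ideal.Quotient.mk (Δ.faceIdeal k) p ∈ Δ.maxHomogeneousIdeal k ^ n ↔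
      ∀ m, Δ.IsFace m.support → m.degree < n → p.coeff m = 0 := by
  rw [maxHomogeneousIdeal_eq_map, ← Ideal.map_pow, ← Ideal.mem_comap,
    Ideal.comap_map_of_surjective _ Ideal.Quotient.mk_surjective, ← RingHom.ker_eq_comap_bot,
    Ideal.mk_ker]
  constructor
  · intro h m hm hn
    obtain ⟨a, ha, b, hb, rfl⟩ := Submodule.mem_sup.1 h
    rw [MvPolynomial.coeff_add, (MvPolynomial.mem_pow_idealOfVars_iff' n a).1 ha m hn,
      mem_faceIdeal_iff.1 hb m hm, add_zero]
  · intro h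
    rw [← p.support_sum_monomial_coeff]
    refine Ideal.sum_mem _ fun m hm => ?_
    have hc := MvPolynomial.mem_support_iff.1 hm
    by_cases hf : Δ.IsFace m.support
    · refine Ideal.mem_sup_left ?_
      rw [MvPolynomial.monomial_mem_pow_idealOfVars_iff _ _ hc]
      exact not_lt.1 fun hn => hc (h m hf hn)
    · refine Ideal.mem_sup_right (mem_faceIdeal_iff.2 fun m' hm' => ?_)
      classical
      rw [MvPolynomial.coeff_monomial, if_neg]
      rintro rfl
      exact hf hm'

end AbstractSimplicialComplex

/-! ### Integral closure in polynomial rings -/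

namespace MvPolynomial

variable {σ R : Type*} [CommSemiring R]

lemma natCast_le_order_coe_iff (n : ℕ) (p : MvPolynomial σ R) :
    (n : ℕ∞) ≤ (p : MvPowerSeries σ R).order ↔ p ∈ idealOfVars σ R ^ n := by
  rw [mem_pow_idealOfVars_iff']
  constructor
  · intro h x hx
    rw [← coeff_coe]
    exact MvPowerSeries.coeff_of_lt_order (lt_of_lt_of_le (by exact_mod_cast hx) h)
  · intro h
    refine MvPowerSeries.nat_le_order fun x hx => ?_
    rw [coeff_coe]
    exact h x hx

/-- Over a domain the order of a power series is additive on products, and N · ord p > N · r forces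
ord p > r. -/
lemma mem_pow_idealOfVars_of_pow_mem {R : Type*} [CommRing R] [IsDomain R] {p : MvPolynomial σ R}
    {N r : ℕ} (h : p ^ N ∈ idealOfVars σ R ^ (N * r + 1)) : p ∈ idealOfVars σ R ^ (r + 1) := by
  rw [← natCast_le_order_coe_iff] at h ⊢
  have hpow : ((p ^ N : MvPolynomial σ R) : MvPowerSeries σ R).order =
      N • (p : MvPowerSeries σ R).order := by
    rw [coe_pow]
    simpa using MvPowerSeries.order_prod (fun _ => (p : MvPowerSeries σ R)) (Finset.range N)
  rw [hpow] at h
  by_contra hlt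
  have hr : (p : MvPowerSeries σ R).order ≤ r := by
    rw [not_le] at hlt
    push_cast at hlt
    exact ENat.lt_add_one_iff (ENat.natCast_ne_top r) |>.1 hlt
  have h1 := h.trans (nsmul_le_nsmul_right hr N)
  rw [nsmul_eq_mul] at h1
  norm_cast at h1
  omega

/-- Powers of the ideal of the variables are integrally closed. -/
lemma mem_pow_idealOfVars_of_isIntegralOverIdeal {R : Type*} [CommRing R] [IsDomain R] {n : ℕ}
    {x : MvPolynomial σ R} (h : IsIntegralOverIdeal (idealOfVars σ R ^ n) x) :
    x ∈ idealOfVars σ R ^ n := by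
  obtain ⟨p, hp, hx, hc⟩ := h
  -- Let N be the degree of the equation. If x has order at least r < n, each term of index i < N
  -- has order at least n(N - i) + ri ≥ Nr + 1, hence so does x^N.
  suffices H : ∀ r ≤ n, x ∈ idealOfVars σ R ^ r from H n le_rfl
  intro r
  induction r with
  | zero => simp
  | succ r ih =>
    intro hr
    have hxr := ih (by omega)
    refine mem_pow_idealOfVars_of_pow_mem (N := p.natDegree) ?_
    rw [Polynomial.eval_eq_sum_range, Finset.sum_range_succ, hp.coeff_natDegree, one_mul] at hx
    rw [eq_neg_of_add_eq_zero_right hx]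
    refine neg_mem (Ideal.sum_mem _ fun i hi => ?_)
    have hi' := Finset.mem_range.1 hi
    have h1 := Ideal.mul_mem_mul (hc i) (Ideal.pow_mem_pow hxr i)
    rw [← pow_mul, ← pow_mul, ← pow_add] at h1
    refine Ideal.pow_le_pow_right ?_ h1
    obtain ⟨j, hj⟩ := Nat.exists_eq_add_of_lt hi'
    rw [hj, show i + j + 1 - i = j + 1 by omega]
    nlinarith

end MvPolynomial

lemma IsIntegralOverIdeal.map {R S : Type*} [CommRing R] [CommRing S] (f : R →+* S) {I : Ideal R}
    {x : R} (h : IsIntegralOverIdeal I x) : IsIntegralOverIdeal (I.map f) (f x) := by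
  obtain ⟨p, hp, hx, hc⟩ := h
  rcases subsingleton_or_nontrivial S with hS | hS
  · exact ⟨1, monic_one, Subsingleton.elim _ _, fun i => by
      rw [Subsingleton.elim ((1 : S[X]).coeff i) 0]; exact zero_mem _⟩
  refine ⟨p.map f, hp.map f, by rw [eval_map_apply, hx, map_zero], fun i => ?_⟩
  rw [coeff_map, hp.natDegree_map, ← Ideal.map_pow]
  exact Ideal.mem_map_of_mem f (hc i)

lemma IsIntegralOverIdeal.mono {R : Type*} [CommRing R] {I J : Ideal R} (hIJ : I ≤ J) {x : R}
    (h : IsIntegralOverIdeal I x) : IsIntegralOverIdeal J x := by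
  obtain ⟨p, hp, hx, hc⟩ := h
  exact ⟨p, hp, hx, fun i => Ideal.pow_right_mono hIJ _ (hc i)⟩

lemma le_integralClosureIdeal {R : Type*} [CommRing R] (I : Ideal R) :
    I ≤ integralClosureIdeal I := by
  intro x hx
  rcases subsingleton_or_nontrivial R with hR | hR
  · rw [Subsingleton.elim x 0]
    exact zero_mem _
  refine ⟨X - C x, monic_X_sub_C x, by simp, fun i => ?_⟩
  rw [natDegree_X_sub_C]
  rcases i with _ | _ | i
  · simpa using hx
  · simp
  · simp [coeff_X]

/-! ### Projections to faces and normality of 𝔪^n -/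

namespace AbstractSimplicialComplex

variable {V : Type*} {k : Type*} [Field k] {Δ : AbstractSimplicialComplex V}

/-- The projection of the face ring onto the polynomial ring in the vertices of a face. -/
def toFacePolynomial (k : Type*) [Field k] {s : Finset V} (hs : Δ.IsFace s) :
    Δ.FaceRing k →+* MvPolynomial s k :=
  Ideal.Quotient.lift (Δ.faceIdeal k)
    (MvPolynomial.killCompl (R := k) (Subtype.val_injective (p := (· ∈ s)))).toRingHom <| by
    intro p hp
    ext m
    refine (MvPolynomial.coeff_killCompl _).trans (mem_faceIdeal_iff.1 hp _ (hs.mono ?_))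
    intro v hv
    classical
    obtain ⟨w, -, rfl⟩ := Finset.mem_image.1 (Finsupp.mapDomain_support hv)
    exact w.2

lemma coeff_toFacePolynomial_mk {s : Finset V} (hs : Δ.IsFace s) (p : MvPolynomial V k)
    (m : s →₀ ℕ) : (toFacePolynomial k hs (Ideal.Quotient.mk _ p)).coeff m =
      p.coeff (m.mapDomain Subtype.val) :=
  MvPolynomial.coeff_killCompl _

lemma toFacePolynomial_surjective {s : Finset V} (hs : Δ.IsFace s) :
    Function.Surjective (toFacePolynomial k hs) := fun q =>
  ⟨Ideal.Quotient.mk _ (MvPolynomial.rename Subtype.val q),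
    MvPolynomial.killCompl_rename_app _ q⟩

lemma map_toFacePolynomial_maxHomogeneousIdeal_le {s : Finset V} (hs : Δ.IsFace s) :
    (Δ.maxHomogeneousIdeal k).map (toFacePolynomial k hs) ≤ MvPolynomial.idealOfVars s k := by
  rw [Ideal.map_le_iff_le_comap, maxHomogeneousIdeal, Ideal.span_le]
  rintro _ ⟨v, rfl⟩
  rw [SetLike.mem_coe, Ideal.mem_comap]
  change MvPolynomial.killCompl _ (MvPolynomial.X v) ∈ _
  rw [MvPolynomial.killCompl, MvPolynomial.aeval_X]
  split_ifs with h
  · exact Ideal.subset_span ⟨_, rfl⟩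
  · exact zero_mem _

lemma exists_mapDomain_val_eq {s : Finset V} {m : V →₀ ℕ} (h : m.support ⊆ s) :
    ∃ m' : s →₀ ℕ, m'.mapDomain Subtype.val = m :=
  ⟨m.comapDomain Subtype.val Subtype.val_injective.injOn,
    Finsupp.mapDomain_comapDomain _ Subtype.val_injective m fun v hv => ⟨⟨v, h hv⟩, rfl⟩⟩

/-- The powers of the maximal homogeneous ideal of a face ring are integrally closed. -/
theorem integralClosureIdeal_maxHomogeneousIdeal_pow (n : ℕ) :
    integralClosureIdeal (Δ.maxHomogeneousIdeal k ^ n) = Δ.maxHomogeneousIdeal k ^ n := by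
  refine le_antisymm (fun x hx => ?_) (le_integralClosureIdeal _)
  obtain ⟨p, rfl⟩ := Ideal.Quotient.mk_surjective x
  rw [mk_mem_maxHomogeneousIdeal_pow_iff]
  intro m hm hn
  -- The coefficient at m is read off after projecting to the face that supports m.
  obtain ⟨m', hm'⟩ := exists_mapDomain_val_eq (subset_refl m.support)
  have h1 := (IsIntegralOverIdeal.map (toFacePolynomial k hm) hx).mono
    ((Ideal.map_pow _ _ n).trans_le
      (Ideal.pow_right_mono (map_toFacePolynomial_maxHomogeneousIdeal_le hm) n))
  have h2 := (MvPolynomial.mem_pow_idealOfVars_iff' n _).1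
    (MvPolynomial.mem_pow_idealOfVars_of_isIntegralOverIdeal h1) m' (by
      rw [← hm', Finsupp.degree_mapDomain] at hn
      exact hn)
  rwa [coeff_toFacePolynomial_mk, hm'] at h2

end AbstractSimplicialComplex

/-! ### Lengths as vector space dimensions -/

/-- If `R` is generated by `K` modulo an ideal `I`, then the length over `R` of a module killed by a
power of `I` is its length over `K`. -/
lemma Module.length_eq_of_pow_smul_top_eq_bot {K R : Type*} [CommRing K] [CommRing R] [Algebra K R]
    (I : Ideal R) (hI : ∀ r : R, ∃ c : K, r - algebraMap K R c ∈ I) (n : ℕ) :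
    ∀ {M : Type*} [AddCommGroup M] [Module R M] [Module K M] [IsScalarTower K R M],
      I ^ n • (⊤ : Submodule R M) = ⊥ → Module.length R M = Module.length K M := by
  have hsurj : Function.Surjective (algebraMap K (R ⧸ I)) := by
    intro x
    obtain ⟨r, rfl⟩ := Ideal.Quotient.mk_surjective x
    obtain ⟨c, hc⟩ := hI r
    exact ⟨c, (Ideal.Quotient.eq.2 hc).symm⟩
  induction n with
  | zero =>
    intro M _ _ _ _ h
    rw [pow_zero, Ideal.one_eq_top, Submodule.top_smul] at h
    have : Subsingleton M := (Submodule.subsingleton_iff R).1 (subsingleton_of_bot_eq_top h.symm)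
    rw [Module.length_eq_zero, Module.length_eq_zero]
  | succ n ih =>
    intro M _ _ _ _ h
    -- Dévissage: I^n kills N = IM, while M/N is a module over R/I, onto which both R and K surject.
    set N : Submodule R M := I • ⊤ with hN
    have hsub : Module.length R N = Module.length K N := by
      refine ih (Submodule.map_injective_of_injective N.injective_subtype ?_)
      rw [Submodule.map_smul'', Submodule.map_subtype_top, Submodule.map_bot, hN,
        ← Submodule.mul_smul, ← pow_succ, h]
    have hquot : Module.length R (M ⧸ N) = Module.length K (M ⧸ N) := by
      have htors : Module.IsTorsionBySet R (M ⧸ N) I := by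
        rw [hN]
        exact Module.isTorsionBySet_quotient_ideal_smul M I
      let _ := htors.module
      have : IsScalarTower R (R ⧸ I) (M ⧸ N) := htors.isScalarTower
      have : IsScalarTower K (R ⧸ I) (M ⧸ N) := htors.isScalarTower
      rw [Module.length_eq_of_surjective (S := R) (R := R ⧸ I) Ideal.Quotient.mk_surjective,
        Module.length_eq_of_surjective (S := K) (R := R ⧸ I) hsurj]
    rw [Module.length_eq_add_of_exact N.subtype N.mkQ N.injective_subtype N.mkQ_surjective
        (LinearMap.exact_subtype_mkQ N),
      Module.length_eq_add_of_exact (N.subtype.restrictScalars K) (N.mkQ.restrictScalars K)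
        N.injective_subtype N.mkQ_surjective (LinearMap.exact_subtype_mkQ N), hsub, hquot]

namespace AbstractSimplicialComplex

variable {V : Type*} {k : Type*} [Field k] {Δ : AbstractSimplicialComplex V}

lemma exists_sub_algebraMap_mem_maxHomogeneousIdeal (x : Δ.FaceRing k) :
    ∃ c : k, x - algebraMap k (Δ.FaceRing k) c ∈ Δ.maxHomogeneousIdeal k := by
  obtain ⟨p, rfl⟩ := Ideal.Quotient.mk_surjective x
  refine ⟨p.coeff 0, ?_⟩
  change _ - Ideal.Quotient.mk _ (MvPolynomial.C _) ∈ _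
  rw [← map_sub, ← pow_one (Δ.maxHomogeneousIdeal k), mk_mem_maxHomogeneousIdeal_pow_iff]
  intro m _ hm
  obtain rfl : m = 0 := (Finsupp.degree_eq_zero_iff m).1 (Nat.lt_one_iff.1 hm)
  simp

/-- The exponents of the monomials in the standard basis of `k[Δ] / 𝔪 ^ n`. -/
def faceExponents (Δ : AbstractSimplicialComplex V) (n : ℕ) : Set (V →₀ ℕ) :=
  {m | Δ.IsFace m.support ∧ m.degree < n}

lemma finite_faceExponents [Finite V] (Δ : AbstractSimplicialComplex V) (n : ℕ) :
    (Δ.faceExponents n).Finite :=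
  (Finsupp.finite_of_degree_lt n).subset fun _ h => h.2

lemma length_quotient_maxHomogeneousIdeal_pow [Finite V] (n : ℕ) :
    Module.length (Δ.FaceRing k) (Δ.FaceRing k ⧸ Δ.maxHomogeneousIdeal k ^ n) =
      (Δ.faceExponents n).ncard := by
  have := (Δ.finite_faceExponents n).fintype
  rw [Module.length_eq_of_pow_smul_top_eq_bot (K := k) (Δ.maxHomogeneousIdeal k)
    exists_sub_algebraMap_mem_maxHomogeneousIdeal n (by
        rw [eq_bot_iff, Submodule.smul_le]
        intro r hr x _
        obtain ⟨y, rfl⟩ := Ideal.Quotient.mk_surjective x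
        exact Ideal.Quotient.eq_zero_iff_mem.2 (Ideal.mul_mem_right y _ hr))]
  -- L reads the coefficients at the basis exponents and Q is the double quotient map; they are
  -- surjective with the same kernel.
  let L : MvPolynomial V k →ₗ[k] (Δ.faceExponents n → k) :=
    LinearMap.pi fun m => MvPolynomial.lcoeff k m.1
  let Q : MvPolynomial V k →ₗ[k] (Δ.FaceRing k ⧸ Δ.maxHomogeneousIdeal k ^ n) :=
    ((Ideal.Quotient.mkₐ k (Δ.maxHomogeneousIdeal k ^ n)).comp
      (Ideal.Quotient.mkₐ k (Δ.faceIdeal k))).toLinearMap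
  have hL : Function.Surjective L := by
    intro g
    refine ⟨∑ m, MvPolynomial.monomial m.1 (g m), ?_⟩
    ext m
    classical
    simp only [L, LinearMap.pi_apply, MvPolynomial.lcoeff_apply, MvPolynomial.coeff_sum,
      MvPolynomial.coeff_monomial]
    simp [Subtype.coe_inj]
  have hQ : Function.Surjective Q :=
    Ideal.Quotient.mk_surjective.comp Ideal.Quotient.mk_surjective
  have hker : LinearMap.ker L = LinearMap.ker Q := by
    ext p
    rw [LinearMap.mem_ker, LinearMap.mem_ker]
    change _ ↔ Ideal.Quotient.mk _ (Ideal.Quotient.mk _ p) = 0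
    rw [Ideal.Quotient.eq_zero_iff_mem, mk_mem_maxHomogeneousIdeal_pow_iff, funext_iff]
    exact ⟨fun h m hm hn => h ⟨m, hm, hn⟩, fun h m => h m.1 m.2.1 m.2.2⟩
  rw [← ((L.quotKerEquivOfSurjective hL).symm.trans ((Submodule.quotEquivOfEq _ _ hker).trans
    (Q.quotKerEquivOfSurjective hQ))).length_eq, Module.length_eq_finrank,
    Module.finrank_fintype_fun_eq_card, Set.ncard_eq_toFinset_card', Set.toFinset_card]

end AbstractSimplicialComplex

/-! ### Counting face monomials -/

lemma degree_eq_sum_of_support_subset {σ : Type*} {m : σ →₀ ℕ} {s : Finset σ}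
    (h : m.support ⊆ s) : m.degree = ∑ v ∈ s, m v :=
  Finset.sum_subset h fun _ _ hv => Finsupp.notMem_support_iff.1 hv

/-- The number of exponents with support `s` and degree less than `n`. -/
lemma ncard_support_eq_degree_lt {σ : Type*} (s : Finset σ) {n : ℕ} (hn : 1 ≤ n) :
    {m : σ →₀ ℕ | m.support = s ∧ m.degree < n}.ncard = (n - 1).choose s.card := by
  classical
  -- Subtracting o leaves an arbitrary exponent on s of degree less than n - |s|; summing over the
  -- degrees is the hockey-stick identity.
  let o : σ →₀ ℕ := Finsupp.indicator s fun _ _ => 1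
  have ho : ∀ v ∈ s, o v = 1 := fun v hv => by simp [o, hv]
  have ho' : ∀ v ∉ s, o v = 0 := fun v hv => by simp [o, hv]
  have hod : o.degree = s.card := by
    rw [degree_eq_sum_of_support_subset (m := o) (s := s)]
    · rw [Finset.sum_congr rfl ho]; simp
    · exact Finsupp.support_indicator_subset ..
  have himage : {m : σ →₀ ℕ | m.support = s ∧ m.degree < n} =
      (((Finset.range (n - s.card)).biUnion fun t => s.finsuppAntidiag t).image (· + o) :
        Finset (σ →₀ ℕ)) := by
    ext m
    simp only [Set.mem_ofPred_eq, Finset.coe_image, Set.mem_image, Finset.mem_coe,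
      Finset.mem_biUnion, Finset.mem_range, Finset.mem_finsuppAntidiag]
    constructor
    · rintro ⟨hs, hd⟩
      have hle : o ≤ m := fun v => by
        by_cases hv : v ∈ s
        · rw [ho v hv]
          exact Nat.one_le_iff_ne_zero.2 (Finsupp.mem_support_iff.1 (hs ▸ hv))
        · rw [ho' v hv]; exact Nat.zero_le _
      have hsub : (m - o).support ⊆ s := (Finsupp.support_tsub ).trans hs.le
      have hadd := tsub_add_cancel_of_le hle
      refine ⟨m - o, ⟨_, ?_, rfl, hsub⟩, hadd⟩
      rw [← degree_eq_sum_of_support_subset hsub]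
      rw [← hadd, map_add, hod] at hd
      omega
    · rintro ⟨u, ⟨t, ht, hu, hus⟩, rfl⟩
      constructor
      · ext v
        by_cases hv : v ∈ s
        · simp [ho v hv, hv]
        · have : u v = 0 := Finsupp.notMem_support_iff.1 fun h => hv (hus h)
          simp [ho' v hv, hv, this]
      · rw [map_add, hod, degree_eq_sum_of_support_subset hus, hu]
        omega
  rw [himage, Set.ncard_coe_finset, Finset.card_image_of_injective _ (add_left_injective o),
    Finset.card_biUnion]
  · simp only [Finset.card_finsuppAntidiag_nat_eq_choose]
    -- For empty s only t = 0 contributes; n ≥ 1 ensures that this t occurs.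
    rcases hs : s.card with _ | j
    · obtain ⟨n, rfl⟩ := Nat.exists_eq_add_of_le' hn
      rw [Nat.sub_zero, Finset.sum_range_succ']
      simp
    · rcases hN : n - (j + 1) with _ | M
      · rw [Finset.range_zero, Finset.sum_empty, Nat.choose_eq_zero_of_lt (by omega)]
      · rw [show n - 1 = M + j + 1 by omega, ← Nat.sum_range_add_choose]
        refine Finset.sum_congr rfl fun t _ => ?_
        rw [show j + 1 + t - 1 = t + j by omega]
        exact Nat.choose_symm_add
  · intro t _ t' _ htt'
    rw [Function.onFun, Finset.disjoint_left]
    intro u hu hu'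
    rw [Finset.mem_finsuppAntidiag] at hu hu'
    exact htt' (hu.1.symm.trans hu'.1)

namespace AbstractSimplicialComplex

variable {V : Type*} {k : Type*} [Field k] {Δ : AbstractSimplicialComplex V}

/-- The Hilbert function of the face ring in terms of the face numbers. -/
lemma ncard_faceExponents [Finite V] {d : ℕ} (hd : Δ.HasDim ((d : ℤ) - 1)) {n : ℕ} (hn : 1 ≤ n) :
    (Δ.faceExponents n).ncard =
      ∑ j ∈ Finset.range (d + 1), Δ.faceNumber ((j : ℤ) - 1) * (n - 1).choose j := by
  classical
  have := Fintype.ofFinite V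
  have hcard : ∀ s, Δ.IsFace s → s.card < d + 1 := fun s hs => by
    have := hd.2 ⟨s, hs, rfl⟩
    omega
  have hface : ∀ j : ℕ, Δ.faceNumber ((j : ℤ) - 1) =
      ((Finset.univ.filter Δ.IsFace).filter fun s => s.card = j).card := fun j => by
    rw [faceNumber, ← Set.ncard_coe_finset]
    congr 1
    ext s
    simp
  have hfin : ∀ s : Finset V, {m : V →₀ ℕ | m.support = s ∧ m.degree < n}.Finite := fun s =>
    (Finsupp.finite_of_degree_lt n).subset fun _ h => h.2
  have h1 : (Δ.faceExponents n).ncard =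
      ∑ s ∈ Finset.univ.filter Δ.IsFace, {m : V →₀ ℕ | m.support = s ∧ m.degree < n}.ncard := by
    have hun : Δ.faceExponents n = ((Finset.univ.filter Δ.IsFace).biUnion
        fun s => (hfin s).toFinset : Finset _) := by
      ext m
      simp [faceExponents]
    rw [hun, Set.ncard_coe_finset, Finset.card_biUnion]
    · exact Finset.sum_congr rfl fun s _ => (Set.ncard_eq_toFinset_card _ (hfin s)).symm
    · intro s _ t _ hst
      rw [Function.onFun, Finset.disjoint_left]
      intro m hm hm'
      rw [Set.Finite.mem_toFinset] at hm hm'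
      exact hst (hm.1.symm.trans hm'.1)
  rw [h1, Finset.sum_congr rfl fun s _ => ncard_support_eq_degree_lt s hn,
    ← Finset.sum_fiberwise_of_maps_to (g := Finset.card) (t := Finset.range (d + 1))
      fun s hs => Finset.mem_range.2 (hcard s (Finset.mem_filter.1 hs).2)]
  refine Finset.sum_congr rfl fun j _ => ?_
  rw [hface, Finset.sum_congr rfl fun s hs => by rw [(Finset.mem_filter.1 hs).2],
    Finset.sum_const, smul_eq_mul]

end AbstractSimplicialComplex

/-! ### Krull dimension and the inequality for pure complexes -/

namespace AbstractSimplicialComplex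

variable {V : Type*} {k : Type*} [Field k] {Δ : AbstractSimplicialComplex V}

/-- Every prime of the face ring contains the kernel of the projection onto the polynomial ring of
some face. -/
lemma exists_ker_toFacePolynomial_le [Finite V] (P : Ideal (Δ.FaceRing k)) [hP : P.IsPrime] :
    ∃ (s : Finset V) (hs : Δ.IsFace s), RingHom.ker (toFacePolynomial k hs) ≤ P := by
  classical
  have := Fintype.ofFinite V
  -- Were s not a face, the product of its variables would be zero in k[Δ], and P would contain one
  -- of them.
  let s : Finset V := Finset.univ.filter fun v =>
    Ideal.Quotient.mk (Δ.faceIdeal k) (MvPolynomial.X v) ∉ P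
  have hs : Δ.IsFace s := by
    by_contra h
    have h0 : Ideal.Quotient.mk (Δ.faceIdeal k) (∏ v ∈ s, MvPolynomial.X v) ∈ P := by
      rw [Ideal.Quotient.eq_zero_iff_mem.2 (show _ ∈ Δ.faceIdeal k from Ideal.subset_span ⟨s, h, rfl⟩)]
      exact zero_mem _
    rw [map_prod, hP.prod_mem_iff] at h0
    obtain ⟨v, hv, hvP⟩ := h0
    exact (Finset.mem_filter.1 hv).2 hvP
  refine ⟨s, hs, fun x hx => ?_⟩
  obtain ⟨p, rfl⟩ := Ideal.Quotient.mk_surjective x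
  rw [RingHom.mem_ker] at hx
  rw [← p.support_sum_monomial_coeff, map_sum]
  refine Ideal.sum_mem _ fun m hm => ?_
  have hms : ¬ m.support ⊆ s := fun h => by
    obtain ⟨m', rfl⟩ := exists_mapDomain_val_eq h
    have := coeff_toFacePolynomial_mk hs p m'
    rw [hx, MvPolynomial.coeff_zero] at this
    exact MvPolynomial.mem_support_iff.1 hm this.symm
  obtain ⟨v, hv, hvs⟩ := Finset.not_subset.1 hms
  have hvP : Ideal.Quotient.mk (Δ.faceIdeal k) (MvPolynomial.X v) ∈ P := by
    by_contra h
    exact hvs (Finset.mem_filter.2 ⟨Finset.mem_univ v, h⟩)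
  have hdvd : (MvPolynomial.X v : MvPolynomial V k) ∣ MvPolynomial.monomial m (p.coeff m) :=
    MvPolynomial.X_dvd_monomial.2 (Or.inr (Finsupp.mem_support_iff.1 hv))
  exact P.mem_of_dvd (map_dvd _ hdvd) hvP

lemma ringKrullDim_mvPolynomial_finset (s : Finset V) :
    ringKrullDim (MvPolynomial s k) = s.card := by
  rw [MvPolynomial.ringKrullDim_of_isNoetherianRing, ringKrullDim_eq_zero_of_field, zero_add]
  simp

/-- The face ring of a complex of dimension `d - 1` has Krull dimension `d`. -/
theorem ringKrullDim_faceRing [Finite V] {d : ℕ} (hd : Δ.HasDim ((d : ℤ) - 1)) :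
    ringKrullDim (Δ.FaceRing k) = d := by
  apply le_antisymm
  -- Primes above P lie in the zero locus of such a kernel, a copy of Spec k[s], which has dimension
  -- |s| ≤ d.
  · rw [ringKrullDim, Order.krullDim_eq_iSup_coheight]
    refine iSup_le fun P => ?_
    obtain ⟨s, hs, hle⟩ := exists_ker_toFacePolynomial_le P.asIdeal
    have hsd : s.card ≤ d := by
      have := hd.2 ⟨s, hs, rfl⟩
      omega
    calc _ = Order.krullDim (Set.Ici P) := Order.coheight_eq_krullDim_Ici P
      _ ≤ Order.krullDim (PrimeSpectrum.zeroLocus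
          (RingHom.ker (toFacePolynomial k hs) : Set (Δ.FaceRing k))) :=
        Order.krullDim_le_of_strictMono (fun Q => ⟨Q.1, hle.trans Q.2⟩) fun _ _ h => h
      _ = ringKrullDim (MvPolynomial s k) := by
        rw [← ringKrullDim_quotient]
        exact ringKrullDim_eq_of_ringEquiv
          (RingHom.quotientKerEquivOfSurjective (toFacePolynomial_surjective hs))
      _ = s.card := ringKrullDim_mvPolynomial_finset s
      _ ≤ d := by exact_mod_cast hsd
  · obtain ⟨s, hs, hsd⟩ := hd.1
    have h : s.card = d := by omega
    rw [← h, ← ringKrullDim_mvPolynomial_finset (k := k) s]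
    exact ringKrullDim_le_of_surjective _ (toFacePolynomial_surjective hs)

/-- In a pure complex of dimension `d - 1`, every codimension one face lies in a facet. -/
lemma faceNumber_le_of_isPure [Finite V] {d : ℕ} (hd : Δ.HasDim ((d : ℤ) - 1)) (h1 : 1 ≤ d)
    (hpure : Δ.IsPure) : Δ.faceNumber ((d : ℤ) - 2) ≤ d * Δ.faceNumber ((d : ℤ) - 1) := by
  classical
  have := Fintype.ofFinite V
  let F : Finset (Finset V) := Finset.univ.filter fun s => Δ.IsFace s ∧ s.card = d
  have hF : Δ.faceNumber ((d : ℤ) - 1) = F.card := by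
    rw [faceNumber, ← Set.ncard_coe_finset]
    congr 1
    ext s
    simp [F]
  have hcard : ∀ s, Δ.IsFacet s → s.card = d := by
    obtain ⟨t, ht, htd⟩ := hd.1
    -- A face of maximal cardinality is a facet, so purity gives every facet d vertices.
    have htf : Δ.IsFacet t := ⟨ht, fun u hu htu => by
      have := hd.2 ⟨u, hu, rfl⟩
      exact (Finset.eq_of_subset_of_card_le htu (by omega)).ge⟩
    intro s hs
    have := hpure s t hs htf
    omega
  have hsub : {s : Finset V | Δ.IsFace s ∧ (s.card : ℤ) - 1 = (d : ℤ) - 2} ⊆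
      (F.biUnion fun t => t.image fun v => t.erase v : Finset (Finset V)) := by
    rintro s ⟨hs, hsd⟩
    obtain ⟨t, hst, ht⟩ := (Set.toFinite {s | Δ.IsFace s}).exists_le_maximal hs
    have htd := hcard t ht
    have hst' : s ⊂ t := hst.ssubset_of_ne (by rintro rfl; omega)
    obtain ⟨v, hv, hvs⟩ := Finset.exists_of_ssubset hst'
    refine Finset.mem_coe.2 (Finset.mem_biUnion.2 ⟨t, by simpa [F, htd] using ht.prop,
      Finset.mem_image.2 ⟨v, hv, ?_⟩⟩)
    refine (Finset.eq_of_subset_of_card_le (fun w hw => Finset.mem_erase.2 ⟨?_, hst hw⟩) ?_).symm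
    · rintro rfl; exact hvs hw
    · rw [Finset.card_erase_of_mem hv]; omega
  calc _ ≤ _ := Set.ncard_le_ncard hsub
    _ = _ := Set.ncard_coe_finset _
    _ ≤ F.card * d := Finset.card_biUnion_le_card_mul _ _ _ fun t ht =>
      Finset.card_image_le.trans_eq (Finset.mem_filter.1 ht).2.2
    _ = _ := by rw [hF, mul_comm]

end AbstractSimplicialComplex

/-! ### Hilbert polynomials and their coefficients -/

/-- Both sides are the j-th forward difference of x ↦ C(x, N) at x = N. With N = n - 1 this is the
change of basis for the Hilbert polynomial. -/
lemma natCast_choose_eq_alternating_sum (N j : ℕ) :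
    (N.choose j : ℤ) = ∑ l ∈ Finset.range (j + 1),
      (-1) ^ (j - l) * (j.choose l : ℤ) * ((N + l).choose l : ℤ) := by
  have h := fwdDiff_iter_eq_sum_shift (1 : ℕ) (fun x => (x.choose N : ℤ)) j N
  simp only [smul_eq_mul, mul_one] at h
  have h2 : ∀ l, (N + l).choose l = (N + l).choose N := fun l => Nat.choose_symm_add.symm
  simp only [h2]
  rw [← h]
  rcases le_or_gt j N with hjN | hjN
  · obtain ⟨b, rfl⟩ := Nat.exists_eq_add_of_le hjN
    rw [fwdDiff_iter_choose]
    exact congrArg _ Nat.choose_symm_add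
  -- The N-th difference is the constant 1, so all later ones vanish.
  · obtain ⟨c, rfl⟩ := Nat.exists_eq_add_of_lt hjN
    rw [show N + c + 1 = (c + 1) + N by omega, Function.iterate_add_apply]
    have := fwdDiff_iter_choose 0 N
    rw [add_zero] at this
    simp only [this, Nat.choose_zero_right, Nat.cast_one]
    rw [Function.iterate_succ_apply, fwdDiff_const, fwdDiff_iter_eq_sum_shift,
      Nat.choose_eq_zero_of_lt (by omega)]
    simp

/-- `preHilbertPoly ℚ i 1` has degree i, so these polynomials are linearly independent. -/
lemma preHilbertPoly_one_sum_injective {d : ℕ} {a b : ℕ → ℚ}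
    (h : ∑ i ∈ Finset.range (d + 1), C (a i) * preHilbertPoly ℚ (d - i) 1 =
      ∑ i ∈ Finset.range (d + 1), C (b i) * preHilbertPoly ℚ (d - i) 1) :
    ∀ i ≤ d, a i = b i := by
  let S : Polynomial.Sequence ℚ := ⟨fun i => preHilbertPoly ℚ i 1, fun i => by
    rw [degree_eq_natDegree, natDegree_preHilbertPoly]
    intro h0
    have := coeff_preHilbertPoly_self ℚ i 1
    rw [h0, coeff_zero] at this
    exact inv_ne_zero (by exact_mod_cast i.factorial_ne_zero) this.symm⟩
  have hli := linearIndependent_iff'.1 S.linearIndependent (Finset.range (d + 1))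
    (fun l => a (d - l) - b (d - l)) (by
      have h' := sub_eq_zero.2 h
      rw [← Finset.sum_sub_distrib, ← Finset.sum_range_reflect] at h'
      rw [← h']
      refine Finset.sum_congr rfl fun l hl => ?_
      have hl' := Finset.mem_range.1 hl
      rw [show d + 1 - 1 - l = d - l by omega, show d - (d - l) = l by omega, ← sub_mul, ← C_sub,
        smul_eq_C_mul])
  intro i hi
  have := hli (d - i) (Finset.mem_range.2 (by omega))
  rw [show d - (d - i) = i by omega] at this
  exact sub_eq_zero.1 this

lemma IsHilbertPolynomial.unique {R : Type*} [CommRing R] {F : ℕ → Ideal R} {P Q : ℚ[X]}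
    (hP : IsHilbertPolynomial F P) (hQ : IsHilbertPolynomial F Q) : P = Q := by
  have key : ∀ᶠ n : ℕ in atTop, P.eval (n : ℚ) = Q.eval (n : ℚ) := by
    filter_upwards [hP, hQ] with n ⟨l, hl, h⟩ ⟨l', hl', h'⟩
    obtain rfl : l = l' := by exact_mod_cast hl.symm.trans hl'
    exact h.trans h'.symm
  obtain ⟨N, hN⟩ := eventually_atTop.1 key
  refine Polynomial.eq_of_infinite_eval_eq _ _
    (((Set.Ici_infinite N).image Nat.cast_injective.injOn).mono ?_)
  rintro _ ⟨n, hn, rfl⟩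
  exact hN n hn

/-- Hilbert coefficients are unique. -/
lemma IsHilbertCoeffs.unique {R : Type*} [CommRing R] {F : ℕ → Ideal R} {e e' : ℕ → ℤ}
    (h : IsHilbertCoeffs F e) (h' : IsHilbertCoeffs F e') {d : ℕ} (hd : ringKrullDim R = d)
    {i : ℕ} (hi : i ≤ d) : e i = e' i := by
  obtain ⟨d₁, hd₁, h⟩ := h
  obtain ⟨d₂, hd₂, h'⟩ := h'
  obtain rfl : d = d₁ := by exact_mod_cast hd.symm.trans hd₁
  obtain rfl : d = d₂ := by exact_mod_cast hd.symm.trans hd₂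
  have := preHilbertPoly_one_sum_injective (h.unique h') i hi
  have h1 := mul_left_cancel₀ (pow_ne_zero i (by norm_num : (-1 : ℚ) ≠ 0)) this
  exact_mod_cast h1

namespace AbstractSimplicialComplex

variable {V : Type*} {k : Type*} [Field k] {Δ : AbstractSimplicialComplex V}

/-- The Hilbert coefficients of a face ring of dimension `d`. -/
def hilbertCoeff (Δ : AbstractSimplicialComplex V) (d i : ℕ) : ℤ :=
  ∑ j ∈ Finset.range (d + 1),
    (-1) ^ (d - j) * (Δ.faceNumber ((j : ℤ) - 1) : ℤ) * (j.choose (d - i) : ℤ)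

/-- C(j, d - 1) vanishes for j < d - 1, so only the two top terms survive. -/
lemma hilbertCoeff_one {d : ℕ} (h1 : 1 ≤ d) :
    Δ.hilbertCoeff d 1 =
      (d : ℤ) * (Δ.faceNumber ((d : ℤ) - 1) : ℤ) - (Δ.faceNumber ((d : ℤ) - 2) : ℤ) := by
  obtain ⟨c, rfl⟩ := Nat.exists_eq_add_of_le' h1
  rw [hilbertCoeff, Finset.sum_range_succ, Finset.sum_range_succ, Finset.sum_eq_zero]
  · have : ((c + 1 : ℕ) : ℤ) - 2 = (c : ℤ) - 1 := by push_cast; ring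
    rw [this]
    simp
    ring
  · intro j hj
    rw [Nat.choose_eq_zero_of_lt (by have := Finset.mem_range.1 hj; omega)]
    simp

lemma isHilbertCoeffs_adicFiltration [Finite V] {d : ℕ} (hd : Δ.HasDim ((d : ℤ) - 1)) :
    IsHilbertCoeffs (adicFiltration (Δ.maxHomogeneousIdeal k)) (Δ.hilbertCoeff d) := by
  refine ⟨d, ringKrullDim_faceRing hd, ?_⟩
  filter_upwards [eventually_ge_atTop 1] with n hn
  refine ⟨_, length_quotient_maxHomogeneousIdeal_pow n, ?_⟩
  rw [ncard_faceExponents hd hn, eval_finsetSum]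
  have key : ∑ i ∈ Finset.range (d + 1), (-1) ^ i * Δ.hilbertCoeff d i *
      ((n - 1 + (d - i)).choose (d - i) : ℤ) =
      ∑ j ∈ Finset.range (d + 1), (Δ.faceNumber ((j : ℤ) - 1) : ℤ) * ((n - 1).choose j : ℤ) := by
    rw [← Finset.sum_range_reflect]
    simp only [hilbertCoeff, Finset.mul_sum, Finset.sum_mul]
    rw [Finset.sum_comm]
    refine Finset.sum_congr rfl fun j hj => ?_
    have hj' := Finset.mem_range.1 hj
    rw [natCast_choose_eq_alternating_sum, Finset.mul_sum]
    -- With l = d - i, the sum over l ≤ j extends to l ≤ d because C(j, l) = 0 for l > j.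
    refine (Finset.sum_subset_zero_on_sdiff (Finset.range_mono (by omega)) ?_ ?_).symm
    · intro l hl
      simp only [Finset.mem_sdiff, Finset.mem_range] at hl
      rw [show d - (d + 1 - 1 - l) = l by omega, Nat.choose_eq_zero_of_lt (n := j) (by omega)]
      simp
    · intro l hl
      have hl' := Finset.mem_range.1 hl
      rw [show d - (d + 1 - 1 - l) = l by omega]
      -- Since d - l = (d - j) + (j - l), the sign of d - j occurs twice and cancels.
      have hsign : (-1 : ℤ) ^ (d + 1 - 1 - l) * (-1) ^ (d - j) = (-1) ^ (j - l) := by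
        rw [show d + 1 - 1 - l = (d - j) + (j - l) by omega, pow_add, mul_right_comm, ← mul_pow]
        simp
      rw [← hsign]
      ring
  have key' := congrArg (Int.cast : ℤ → ℚ) key
  push_cast at key' ⊢
  rw [← key']
  refine Finset.sum_congr rfl fun i _ => ?_
  rw [eval_mul, eval_C, preHilbertPoly_eq_choose_sub_add _ _ hn]

end AbstractSimplicialComplex

end

theorem mainTheorem9 {k : Type*} [Field k] {V : Type*} [Finite V]
    (Δ : AbstractSimplicialComplex V) (d : ℕ) (hd : Δ.HasDim ((d : ℤ) - 1)) :
    (∀ n : ℕ, integralClosureIdeal (Δ.maxHomogeneousIdeal k ^ n) = Δ.maxHomogeneousIdeal k ^ n) ∧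
    (∃ e : ℕ → ℤ, IsHilbertCoeffs (adicFiltration (Δ.maxHomogeneousIdeal k)) e) ∧
    (∃ e' : ℕ → ℤ, IsHilbertCoeffs (normalFiltration (Δ.maxHomogeneousIdeal k)) e') ∧
    (1 ≤ d → ∀ e e' : ℕ → ℤ,
      IsHilbertCoeffs (adicFiltration (Δ.maxHomogeneousIdeal k)) e →
      IsHilbertCoeffs (normalFiltration (Δ.maxHomogeneousIdeal k)) e' →
        e' 1 = e 1 ∧
        e 1 = (d : ℤ) * (Δ.faceNumber ((d : ℤ) - 1) : ℤ) - (Δ.faceNumber ((d : ℤ) - 2) : ℤ) ∧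
        (Δ.IsPure → 0 ≤ e' 1 ∧ 0 ≤ e 1)) := by
  have hnormal : normalFiltration (Δ.maxHomogeneousIdeal k) =
      adicFiltration (Δ.maxHomogeneousIdeal k) :=
    funext AbstractSimplicialComplex.integralClosureIdeal_maxHomogeneousIdeal_pow
  have hH := AbstractSimplicialComplex.isHilbertCoeffs_adicFiltration (k := k) hd
  refine ⟨AbstractSimplicialComplex.integralClosureIdeal_maxHomogeneousIdeal_pow, ⟨_, hH⟩, ⟨_, hnormal ▸ hH⟩, ?_⟩
  intro h1 e e' he he'
  rw [hnormal] at he'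
  have hdim := AbstractSimplicialComplex.ringKrullDim_faceRing (k := k) hd
  have hee' := he'.unique he hdim h1
  have he1 := (he.unique hH hdim h1).trans (AbstractSimplicialComplex.hilbertCoeff_one h1)
  refine ⟨hee', he1, fun hpure => ?_⟩
  have hle := AbstractSimplicialComplex.faceNumber_le_of_isPure hd h1 hpure
  have hnonneg : 0 ≤ e 1 := by
    rw [he1, sub_nonneg]
    exact_mod_cast hle
  exact ⟨hee' ▸ hnonneg, hnonneg⟩
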